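/- For an integrable function $u$ on $\mathbb{R}$ write $\widehat{u}(\xi)=\int_{\mathbb{R}}u(x)e^{-2\pi i\xi x}\,dx$. (1) There is a constant $c>0$ such that for all (complex-valued) $u\in L^1(\mathbb{R})$ $$\big\|\widehat{u}\cdot|\xi|^2\big\|_{L^\infty(\mathbb{R})}^2\cdot\big\|u\cdot|x|^2\big\|_{L^1(\mathbb{R})}^2\;\ge\; c\,\|u\|_{L^1(\mathbb{R})}^4,$$ where the norms on the left may be infinite (and $0\cdot\infty=0$, which occurs only for $u=0$). (2) The triangle function $u_0(x)=\max\{1-|x|,0\}$ is a local extremizer for this inequality with respect to perturbations by symmetric $C^3$ functions supported on $[-1,1]$ with nonnegative Fourier transform, in the following sense. Let $f:\mathbb{R}\to\mathbb{R}$ be even, not identically zero, vanish outside $[-1,1]$, be three times continuously differentiable on $[-1,1]$ (one-sided derivatives at $\pm1$), and satisfy $\widehat{f}(\xi)\ge 0$ for all $\xi\in\mathbb{R}$. Put $$J_f(\varepsilon)=\frac{\big\|\widehat{(u_0+\varepsilon f)}\cdot|\xi|^2\big\|_{L^\infty}^2\cdot\big\|(u_0+\varepsilon f)\cdot|x|^2\big\|_{L^1}^2}{\|u_0+\varepsilon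 f\|_{L^1}^4}.$$ Then $J_f(\varepsilon)$ is finite for all sufficiently small $\varepsilon\ge 0$, the right-hand derivative $J_f'(0^+)=\lim_{\varepsilon\to0^+}\frac{J_f(\varepsilon)-J_f(0)}{\varepsilon}$ exists and is strictly positive, and in particular $J_f(\varepsilon)>J_f(0)$ for all sufficiently small $\varepsilon>0$. -/

import Mathlib

open MeasureTheory Set Filter Topology
open scoped ENNReal FourierTransform

noncomputable section

/-- `‖û · |ξ|²‖_{L^∞(ℝ)}` as an extended nonnegative number, where
`û(ξ) = ∫ u(x) e^{-2πiξx} dx`. -/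
def fourierSecondMomentSup (u : ℝ → ℂ) : ℝ≥0∞ :=
  eLpNorm (fun ξ : ℝ => 𝓕 u ξ * ((|ξ| ^ 2 : ℝ) : ℂ)) ∞ volume

/-- `‖u · |x|²‖_{L¹(ℝ)}` as an extended nonnegative number. -/
def secondMomentNorm (u : ℝ → ℂ) : ℝ≥0∞ :=
  eLpNorm (fun x : ℝ => u x * ((|x| ^ 2 : ℝ) : ℂ)) 1 volume

/-- The quotient `‖û · |ξ|²‖²_{L^∞} · ‖u · |x|²‖²_{L¹} / ‖u‖⁴_{L¹}`. -/
def uncertaintyQuotient (u : ℝ → ℂ) : ℝ≥0∞ :=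
  fourierSecondMomentSup u ^ 2 * secondMomentNorm u ^ 2 / eLpNorm u 1 volume ^ 4

/-- The triangle function: `1 - |x|` on `[-1,1]`, and `0` elsewhere. -/
def triangleFun (x : ℝ) : ℝ := max (1 - |x|) 0

/-- Real symmetric functions supported on `[-1,1]`, of class `C³` on `[-1,1]` (with one-sided
derivatives at the endpoints), with nonnegative Fourier transform. In particular every even `C³`
function on `ℝ` with support in `[-1,1]` and nonnegative Fourier transform qualifies. -/
structure IsAdmissiblePerturbation (f : ℝ → ℝ) : Prop where
  even : ∀ x, f (-x) = f x
  support_subset : Function.support f ⊆ Icc (-1) 1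
  contDiffOn : ContDiffOn ℝ 3 f (Icc (-1) 1)
  fourier_re_nonneg : ∀ ξ : ℝ, 0 ≤ (𝓕 (fun x : ℝ => (f x : ℂ)) ξ).re
  fourier_im_eq_zero : ∀ ξ : ℝ, (𝓕 (fun x : ℝ => (f x : ℂ)) ξ).im = 0

/-- The perturbed triangle function `u₀ + ε f`, regarded as complex valued. -/
def perturbedTriangle (f : ℝ → ℝ) (ε : ℝ) (x : ℝ) : ℂ :=
  ((triangleFun x + ε * f x : ℝ) : ℂ)

/-- The perturbation functional `J_f(ε)`: the quotient evaluated at `u₀ + ε f`. -/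
def perturbationFunctional (f : ℝ → ℝ) (ε : ℝ) : ℝ≥0∞ :=
  uncertaintyQuotient (perturbedTriangle f ε)

end

/-! For the inequality, write `M`, `A`, `N` for `‖u‖₁`, `‖û ξ²‖_∞`, `‖u x²‖₁`. Since `|û| ≤ min(M,
A/ξ²)`, Fourier inversion gives `‖u‖_∞ ≲ √(AM)` (`ae_norm_le_of_fourier_decay`). Splitting `∫ |u|`
at a radius `r` then bounds `M` by `r √(AM) + N/r²` up to constants, and optimizing `r` yields `M² ≲
AN`.

For the perturbation, put `F(w) = ∫ f(x) cos(wx) dx` and `ψ(w) = w² F(w)`. Integrating by parts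
twice, `F ≥ 0` forces the oscillating boundary terms to vanish, so `f(±1) = 0` and `ψ` is Lipschitz
and `O(1/w)` (`boundary_and_decay`). Hence `u₀ + εf ≥ 0` for small `ε`, and both `L¹` norms are
affine in `ε`. The Fourier factor of `u₀` peaks exactly where `w = 2πξ` is an odd multiple of `π`,
so to first order in `ε` its supremum grows with slope `G/(4π²)`, where `G` is the supremum of `ψ`
at those points (`fourierSecondMomentSup_perturbed_bounds`).

Up to a positive factor the derivative is therefore `G/4 + ∫ f (6x² - 2)`. The cosine series of `6x²
- 2` and `∑ 1/n⁴ = π⁴/96` over odd `n` turn this into a series with terms `24/(πn)⁴` times `G -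
ψ(πn)` for odd `n` and `ψ(πn)` for even `n`, all nonnegative. If all vanish, decay gives `G = 0`, so
`f` is constant on `[-1,1]`, hence zero (`moment_positivity`). -/

/-! ### Fourier inversion almost everywhere. -/

/-- Without continuity of `u`, both sides are compared by duality: a smooth compactly supported test
function is the transform of a Schwartz function, and the multiplication formula, used once for `u`
and once for `𝓕 u`, moves the transforms across. -/
theorem MeasureTheory.Integrable.ae_eq_fourierInv_fourier {u : ℝ → ℂ} (hu : Integrable u)
    (hû : Integrable (𝓕 u)) : ∀ᵐ x, u x = 𝓕⁻ (𝓕 u) x := by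
  have hcont : Continuous (𝓕⁻ (𝓕 u)) := by
    rw [Real.fourierInv_eq_fourier_comp_neg]
    exact VectorFourier.fourierIntegral_continuous Real.continuous_fourierChar
      (by exact continuous_inner) hû.comp_neg
  refine ae_eq_of_integral_contDiff_smul_eq hu.locallyIntegrable hcont.locallyIntegrable ?_
  intro g hg hgs
  have hG : ContDiff ℝ (⊤ : ℕ∞) (fun x => (g x : ℂ)) := Complex.ofRealCLM.contDiff.comp hg
  have hGs : HasCompactSupport (fun x => (g x : ℂ)) :=
    hgs.comp_left (g := fun y : ℝ => (y : ℂ)) Complex.ofReal_zero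
  let G : SchwartzMap ℝ ℂ := hGs.toSchwartzMap hG
  have hGc : ∀ x, G x = g x := fun x => rfl
  let φ : SchwartzMap ℝ ℂ := 𝓕⁻ G
  have hφ : 𝓕 (φ : ℝ → ℂ) = G := by
    rw [← SchwartzMap.fourier_coe]
    exact congrArg DFunLike.coe (FourierTransform.fourier_fourierInv_eq G)
  have hφ' : 𝓕⁻ (G : ℝ → ℂ) = φ := (SchwartzMap.fourierInv_coe G).symm
  have h1 : ∫ ξ, 𝓕 u ξ • φ ξ = ∫ x, u x • 𝓕 (φ : ℝ → ℂ) x := by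
    simpa using! (VectorFourier.integral_fourierIntegral_smul_eq_flip (L := innerₗ ℝ)
      Real.continuous_fourierChar continuous_inner hu φ.integrable)
  have h2 : ∫ ξ, 𝓕 (fun x => 𝓕 u (-x)) ξ • G ξ =
      ∫ x, 𝓕 u (-x) • 𝓕 (G : ℝ → ℂ) x := by
    simpa using! (VectorFourier.integral_fourierIntegral_smul_eq_flip (L := innerₗ ℝ)
      Real.continuous_fourierChar continuous_inner hû.comp_neg G.integrable)
  rw [← Real.fourierInv_eq_fourier_comp_neg] at h2
  have h3 : ∫ x, 𝓕 u (-x) • 𝓕 (G : ℝ → ℂ) x = ∫ ξ, 𝓕 u ξ • φ ξ := by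
    rw [← integral_neg_eq_self]
    congr with x
    rw [← hφ', Real.fourierInv_eq_fourier_neg, neg_neg]
  calc ∫ x, g x • u x = ∫ x, u x • 𝓕 (φ : ℝ → ℂ) x := by
        congr with x; rw [hφ, hGc, Complex.real_smul, smul_eq_mul, mul_comm]
    _ = ∫ ξ, 𝓕⁻ (𝓕 u) ξ • G ξ := by rw [← h1, ← h3, h2]
    _ = ∫ x, g x • 𝓕⁻ (𝓕 u) x := by
        congr with x; rw [hGc, Complex.real_smul, smul_eq_mul, mul_comm]

theorem fourier_continuous_of_integrable {u : ℝ → ℂ} (hu : Integrable u) : Continuous (𝓕 u) :=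
  VectorFourier.fourierIntegral_continuous Real.continuous_fourierChar
    (by exact continuous_inner) hu

theorem norm_fourier_le_integral_norm (u : ℝ → ℂ) (ξ : ℝ) : ‖𝓕 u ξ‖ ≤ ∫ x, ‖u x‖ :=
  VectorFourier.norm_fourierIntegral_le_integral_norm _ _ _ _ _

theorem norm_fourierInv_le_integral_norm (u : ℝ → ℂ) (ξ : ℝ) : ‖𝓕⁻ u ξ‖ ≤ ∫ x, ‖u x‖ := by
  rw [Real.fourierInv_eq_fourier_neg]
  exact norm_fourier_le_integral_norm u _

/-! ### The global inequality. -/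

/-- A bounded integrable majorant of `𝓕 u` yields an almost everywhere bound on `u`. -/
theorem ae_norm_le_of_fourier_decay {u : ℝ → ℂ} (hu : Integrable u) {M A : ℝ} (hM : 0 < M)
    (hA : 0 < A) (huM : ∫ x, ‖u x‖ ≤ M) (huA : ∀ᵐ ξ, ‖𝓕 u ξ‖ * ξ ^ 2 ≤ A) :
    ∀ᵐ x, ‖u x‖ ≤ 2 * Real.pi * √(A * M) := by
  -- The bounds `M` and `A/ξ²` cross at `|ξ| = 1/c`, so `2M/(1 + (cξ)²)` dominates their minimum.
  set c := √(M / A) with hc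
  have hc0 : 0 < c := Real.sqrt_pos.2 (by positivity)
  have hc2 : c ^ 2 = M / A := Real.sq_sqrt (by positivity)
  have hle : ∀ᵐ ξ, ‖𝓕 u ξ‖ ≤ 2 * M * (1 + (c * ξ) ^ 2)⁻¹ := by
    filter_upwards [huA] with ξ hξ
    have h1 := (norm_fourier_le_integral_norm u ξ).trans huM
    rw [← div_eq_mul_inv, le_div_iff₀ (by positivity), mul_pow, hc2]
    have h2 : M / A * (‖𝓕 u ξ‖ * ξ ^ 2) ≤ M / A * A := by gcongr
    rw [div_mul_cancel₀ _ hA.ne'] at h2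
    nlinarith
  have hint : Integrable (fun ξ : ℝ => 2 * M * (1 + (c * ξ) ^ 2)⁻¹) :=
    (integrable_inv_one_add_sq.comp_mul_left' hc0.ne').const_mul _
  have hval : ∫ ξ : ℝ, 2 * M * (1 + (c * ξ) ^ 2)⁻¹ = 2 * Real.pi * √(A * M) := by
    rw [integral_const_mul, Measure.integral_comp_mul_left (fun x : ℝ => (1 + x ^ 2)⁻¹) c,
      integral_univ_inv_one_add_sq, abs_of_pos (inv_pos.2 hc0), smul_eq_mul]
    have : √(A * M) = M * c⁻¹ := by
      rw [Real.sqrt_eq_iff_mul_self_eq (by positivity) (by positivity)]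
      have : M * c⁻¹ * (M * c⁻¹) = M ^ 2 / c ^ 2 := by field_simp
      rw [this, hc2]; field_simp
    rw [this]; ring
  have hû : Integrable (𝓕 u) :=
    hint.mono' (fourier_continuous_of_integrable hu).aestronglyMeasurable hle
  filter_upwards [hu.ae_eq_fourierInv_fourier hû] with x hx
  rw [hx, ← hval]
  exact (norm_fourierInv_le_integral_norm _ x).trans (integral_mono_ae hû.norm hint hle)

theorem sq_integral_norm_le_of_pos {u : ℝ → ℂ} (hu : Integrable u) {A N : ℝ} (hA : 0 < A)
    (hN : 0 < N) (huA : ∀ᵐ ξ, ‖𝓕 u ξ‖ * ξ ^ 2 ≤ A)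
    (hu2 : Integrable (fun x => ‖u x‖ * x ^ 2)) (huN : ∫ x, ‖u x‖ * x ^ 2 ≤ N) :
    (∫ x, ‖u x‖) ^ 2 ≤ 128 * Real.pi ^ 2 * (A * N) := by
  set M := ∫ x, ‖u x‖ with hMdef
  have hM0 : 0 ≤ M := integral_nonneg fun x => norm_nonneg (u x)
  rcases hM0.eq_or_lt with h0 | hM
  · rw [← h0, zero_pow two_ne_zero]; positivity
  have hb := ae_norm_le_of_fourier_decay hu hM hA le_rfl huA
  set K := 2 * Real.pi * √(A * M) with hK
  have hK0 : 0 ≤ K := by positivity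
  -- With this radius the tail `N / r²` equals `M / 2` and is absorbed on the left.
  set r := √(2 * N / M) with hr
  have hr0 : 0 < r := Real.sqrt_pos.2 (by positivity)
  have hr2 : r ^ 2 = 2 * N / M := Real.sq_sqrt (by positivity)
  have hi1 : Integrable ((Icc (-r) r).indicator fun _ : ℝ => K) :=
    (integrable_indicator_iff measurableSet_Icc).2 (integrableOn_const (by simp))
  have key : M ≤ 2 * r * K + N / r ^ 2 := by
    calc M ≤ ∫ x, ((Icc (-r) r).indicator (fun _ : ℝ => K) x + ‖u x‖ * x ^ 2 / r ^ 2) := by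
          refine integral_mono_ae hu.norm (hi1.add (hu2.div_const _)) ?_
          filter_upwards [hb] with x hx
          by_cases h : x ∈ Icc (-r) r
          · simp only [indicator_of_mem h]
            have : 0 ≤ ‖u x‖ * x ^ 2 / r ^ 2 := by positivity
            linarith
          · simp only [indicator_of_notMem h, zero_add]
            rw [le_div_iff₀ (by positivity)]
            gcongr 1
            rw [mem_Icc, ← abs_le] at h
            rw [← sq_abs x]
            gcongr
            exact (not_le.1 h).le
      _ = 2 * r * K + (∫ x, ‖u x‖ * x ^ 2) / r ^ 2 := by
          rw [integral_add hi1 (hu2.div_const _), integral_indicator measurableSet_Icc,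
            setIntegral_const, integral_div]
          simp [Measure.real, ENNReal.toReal_ofReal, hr0.le]
          left
          ring
      _ ≤ _ := by gcongr
  rw [hr2] at key
  have h1 : N / (2 * N / M) = M / 2 := by field_simp
  rw [h1] at key
  have h2 : M ≤ 4 * r * K := by linarith
  have h3 : M ^ 2 ≤ (4 * r * K) ^ 2 := by gcongr
  have h4 : (4 * r * K) ^ 2 = 128 * Real.pi ^ 2 * (A * N) := by
    have : (√(A * M)) ^ 2 = A * M := Real.sq_sqrt (by positivity)
    rw [mul_pow, mul_pow, hr2, hK, mul_pow, this]
    have : M ≠ 0 := hM.ne'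
    field_simp; ring
  linarith

theorem sq_integral_norm_le {u : ℝ → ℂ} (hu : Integrable u) {A : ℝ} (hA : 0 ≤ A)
    (huA : ∀ᵐ ξ, ‖𝓕 u ξ‖ * ξ ^ 2 ≤ A) (hu2 : Integrable (fun x => ‖u x‖ * x ^ 2)) :
    (∫ x, ‖u x‖) ^ 2 ≤ 128 * Real.pi ^ 2 * (A * ∫ x, ‖u x‖ * x ^ 2) := by
  set N := ∫ x, ‖u x‖ * x ^ 2
  have hN : 0 ≤ N := integral_nonneg fun x => by positivity
  -- Raising both bounds by `δ > 0` makes them strictly positive; then `δ → 0`.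
  have hcont : Tendsto (fun δ : ℝ => 128 * Real.pi ^ 2 * ((A + δ) * (N + δ))) (𝓝[>] 0)
      (𝓝 (128 * Real.pi ^ 2 * ((A + 0) * (N + 0)))) :=
    (Continuous.tendsto (by fun_prop) 0).mono_left nhdsWithin_le_nhds
  rw [add_zero, add_zero] at hcont
  refine ge_of_tendsto hcont ?_
  filter_upwards [self_mem_nhdsWithin] with δ (hδ : 0 < δ)
  refine sq_integral_norm_le_of_pos hu (by positivity) (by positivity) ?_ hu2 (by linarith)
  filter_upwards [huA] with ξ hξ
  linarith

theorem fourierSecondMomentSup_eq (u : ℝ → ℂ) :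
    fourierSecondMomentSup u = eLpNormEssSup (fun ξ : ℝ => ‖𝓕 u ξ‖ * ξ ^ 2) volume := by
  rw [fourierSecondMomentSup, ← eLpNorm_exponent_top]
  refine eLpNorm_congr_norm_ae (ae_of_all _ fun ξ => ?_)
  simp

theorem secondMomentNorm_eq (u : ℝ → ℂ) :
    secondMomentNorm u = eLpNorm (fun x : ℝ => ‖u x‖ * x ^ 2) 1 volume := by
  rw [secondMomentNorm]
  refine eLpNorm_congr_norm_ae (ae_of_all _ fun ξ => ?_)
  simp

/-- If either factor is zero, `u` vanishes almost everywhere. These cases are settled first, so that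
an infinite factor makes the right side infinite instead of `0 · ∞`. -/
theorem eLpNorm_one_pow_four_le {u : ℝ → ℂ} (hu : Integrable u) :
    ENNReal.ofReal (1 / (128 * Real.pi ^ 2) ^ 2) * eLpNorm u 1 volume ^ 4 ≤
      fourierSecondMomentSup u ^ 2 * secondMomentNorm u ^ 2 := by
  have hzero : (∀ᵐ x, u x = 0) → eLpNorm u 1 volume = 0 := fun h => by
    rw [eLpNorm_congr_ae (g := fun _ => (0 : ℂ)) h]; simp
  have hmeas2 : AEStronglyMeasurable (fun x : ℝ => ‖u x‖ * x ^ 2) :=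
    hu.aestronglyMeasurable.norm.mul (by fun_prop)
  by_cases hN0 : secondMomentNorm u = 0
  · rw [secondMomentNorm_eq, eLpNorm_eq_zero_iff hmeas2 one_ne_zero] at hN0
    rw [hzero]
    · simp
    · have h0 : ∀ᵐ x : ℝ, x ≠ 0 := by simp [ae_iff]
      filter_upwards [hN0, h0] with x hx hx0
      simpa [hx0] using hx
  by_cases hA0 : fourierSecondMomentSup u = 0
  · have hF : ∀ᵐ ξ, 𝓕 u ξ = 0 := by
      rw [fourierSecondMomentSup_eq, eLpNormEssSup_eq_zero_iff] at hA0
      have h0 : ∀ᵐ x : ℝ, x ≠ 0 := by simp [ae_iff]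
      filter_upwards [hA0, h0] with x hx hx0
      simpa [hx0] using hx
    rw [hzero]
    · simp
    · filter_upwards [hu.ae_eq_fourierInv_fourier
        ((integrable_zero ℝ ℂ volume).congr (by filter_upwards [hF] with x hx; simp [hx]))]
        with x hx
      rw [hx, ← norm_le_zero_iff]
      refine (norm_fourierInv_le_integral_norm _ x).trans_eq ?_
      exact integral_eq_zero_of_ae (by filter_upwards [hF] with x hx; simp [hx])
  by_cases hN : secondMomentNorm u = ∞
  · rw [hN]; simp [hA0, ENNReal.mul_top]
  by_cases hA : fourierSecondMomentSup u = ∞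
  · rw [hA]; simp [hN0, ENNReal.top_mul]
  have hu2 : Integrable (fun x : ℝ => ‖u x‖ * x ^ 2) := by
    rw [← memLp_one_iff_integrable]
    exact ⟨hmeas2, by rw [← secondMomentNorm_eq]; exact lt_top_iff_ne_top.2 hN⟩
  have hmain := sq_integral_norm_le hu (A := (fourierSecondMomentSup u).toReal)
    ENNReal.toReal_nonneg (by
      filter_upwards [ae_le_eLpNormEssSup (f := fun ξ : ℝ => ‖𝓕 u ξ‖ * ξ ^ 2) (μ := volume)]
        with ξ hξ
      rw [← fourierSecondMomentSup_eq] at hξ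
      have := ENNReal.toReal_mono hA hξ
      simpa using this) hu2
  have e1 : eLpNorm u 1 volume = ENNReal.ofReal (∫ x, ‖u x‖) := by
    rw [eLpNorm_one_eq_lintegral_enorm, ofReal_integral_norm_eq_lintegral_enorm hu]
  have e2 : secondMomentNorm u = ENNReal.ofReal (∫ x, ‖u x‖ * x ^ 2) := by
    rw [secondMomentNorm_eq, eLpNorm_one_eq_lintegral_enorm,
      ← ofReal_integral_norm_eq_lintegral_enorm hu2]
    congr 2 with x; simp
  rw [← ENNReal.ofReal_toReal hA, e1, e2, ← ENNReal.ofReal_pow (by positivity),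
    ← ENNReal.ofReal_pow (by positivity), ← ENNReal.ofReal_pow (by positivity),
    ← ENNReal.ofReal_mul (by positivity), ← ENNReal.ofReal_mul (by positivity)]
  refine ENNReal.ofReal_le_ofReal ?_
  rw [one_div, inv_mul_le_iff₀ (by positivity)]
  have := pow_le_pow_left₀ (by positivity) hmain 2
  calc _ = ((∫ x, ‖u x‖) ^ 2) ^ 2 := by ring
    _ ≤ _ := this
    _ = _ := by ring

/-! ### Cosine transforms and integration by parts. -/

/-- The cosine transform `∫_{-1}^1 h(x) cos(w x) dx`. -/
noncomputable def cosTransform (h : ℝ → ℝ) (w : ℝ) : ℝ :=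
  ∫ x in (-1 : ℝ)..1, h x * Real.cos (w * x)

theorem ContinuousOn.intervalIntegrable_neg_one_one {h : ℝ → ℝ} (hc : ContinuousOn h (Icc (-1) 1)) :
    IntervalIntegrable h volume (-1) 1 :=
  ContinuousOn.intervalIntegrable (by rwa [uIcc_of_le (by norm_num)])

theorem integral_eq_intervalIntegral_of_support_subset {E : Type*} [NormedAddCommGroup E]
    [NormedSpace ℝ E] {h : ℝ → E} (hs : Function.support h ⊆ Icc (-1) 1) :
    ∫ x, h x = ∫ x in (-1 : ℝ)..1, h x := by
  rw [intervalIntegral.integral_of_le (by norm_num), ← integral_Icc_eq_integral_Ioc,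
    setIntegral_eq_integral_of_forall_compl_eq_zero]
  intro x hx
  exact Function.notMem_support.1 fun h => hx (hs h)

theorem integral_cos_sub_I_mul_sin {h : ℝ → ℝ} (heven : ∀ x, h (-x) = h x)
    (hc : ContinuousOn h (Icc (-1) 1)) (w : ℝ) :
    ∫ x in (-1 : ℝ)..1, (((h x * Real.cos (w * x) : ℝ) : ℂ) -
      Complex.I * ((h x * Real.sin (w * x) : ℝ) : ℂ)) = (cosTransform h w : ℂ) := by
  have hsin : ∫ x in (-1 : ℝ)..1, h x * Real.sin (w * x) = 0 := by
    have h1 := intervalIntegral.integral_comp_neg (a := -1) (b := 1)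
      (fun x => h x * Real.sin (w * x))
    simp only [heven, mul_neg, Real.sin_neg, intervalIntegral.integral_neg, neg_neg] at h1
    linarith
  have hi1 : IntervalIntegrable (fun x => h x * Real.cos (w * x)) volume (-1) 1 :=
    (hc.mul (by fun_prop)).intervalIntegrable_neg_one_one
  have hi2 : IntervalIntegrable (fun x => h x * Real.sin (w * x)) volume (-1) 1 :=
    (hc.mul (by fun_prop)).intervalIntegrable_neg_one_one
  have hi1' : IntervalIntegrable (fun x => ((h x * Real.cos (w * x) : ℝ) : ℂ)) volume (-1) 1 :=
    ⟨hi1.1.ofReal, hi1.2.ofReal⟩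
  have hi2' : IntervalIntegrable (fun x => ((h x * Real.sin (w * x) : ℝ) : ℂ)) volume (-1) 1 :=
    ⟨hi2.1.ofReal, hi2.2.ofReal⟩
  rw [intervalIntegral.integral_sub hi1' (hi2'.const_mul _),
    intervalIntegral.integral_const_mul, intervalIntegral.integral_ofReal,
    intervalIntegral.integral_ofReal, hsin, cosTransform]
  simp

theorem fourier_ofReal_eq_cosTransform {h : ℝ → ℝ} (heven : ∀ x, h (-x) = h x)
    (hs : Function.support h ⊆ Icc (-1) 1) (hc : ContinuousOn h (Icc (-1) 1)) (ξ : ℝ) :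
    𝓕 (fun x : ℝ => (h x : ℂ)) ξ = (cosTransform h (2 * Real.pi * ξ) : ℂ) := by
  rw [Real.fourier_real_eq_integral_exp_smul, integral_eq_intervalIntegral_of_support_subset,
    ← integral_cos_sub_I_mul_sin heven hc]
  · congr with x
    rw [show -2 * Real.pi * x * ξ = -(2 * Real.pi * ξ * x) by ring, Complex.exp_mul_I,
      ← Complex.ofReal_cos, ← Complex.ofReal_sin, Real.cos_neg, Real.sin_neg, smul_eq_mul]
    push_cast; ring
  · intro x hx
    apply hs
    contrapose! hx
    simp_all

theorem ContDiffOn.exists_hasDerivAt_Ioo {f : ℝ → ℝ} {n : ℕ}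
    (hf : ContDiffOn ℝ (n + 1) f (Icc (-1) 1)) :
    ∃ f' : ℝ → ℝ, ContDiffOn ℝ n f' (Icc (-1) 1) ∧ ∀ x ∈ Ioo (-1 : ℝ) 1, HasDerivAt f (f' x) x := by
  refine ⟨derivWithin f (Icc (-1) 1),
    hf.derivWithin (uniqueDiffOn_Icc (by norm_num)) le_rfl, fun x hx => ?_⟩
  have h1 : DifferentiableWithinAt ℝ f (Icc (-1) 1) x :=
    hf.differentiableOn (by simp) x (Ioo_subset_Icc_self hx)
  exact h1.hasDerivWithinAt.hasDerivAt (Icc_mem_nhds hx.1 hx.2)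

theorem sq_mul_cosTransform {f f₁ f₂ : ℝ → ℝ} (hf : ContinuousOn f (Icc (-1) 1))
    (hf₁ : ContinuousOn f₁ (Icc (-1) 1)) (hf₂ : ContinuousOn f₂ (Icc (-1) 1))
    (hd : ∀ x ∈ Ioo (-1 : ℝ) 1, HasDerivAt f (f₁ x) x)
    (hd₁ : ∀ x ∈ Ioo (-1 : ℝ) 1, HasDerivAt f₁ (f₂ x) x) (w : ℝ) :
    w ^ 2 * cosTransform f w = w * Real.sin w * (f 1 + f (-1)) +
      Real.cos w * (f₁ 1 - f₁ (-1)) - cosTransform f₂ w := by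
  have hi : IntervalIntegrable (fun x => f x * Real.cos (w * x)) volume (-1) 1 :=
    (hf.mul (by fun_prop)).intervalIntegrable_neg_one_one
  have hi2 : IntervalIntegrable (fun x => f₂ x * Real.cos (w * x)) volume (-1) 1 :=
    (hf₂.mul (by fun_prop)).intervalIntegrable_neg_one_one
  have key := intervalIntegral.integral_eq_sub_of_hasDerivAt_of_le (a := -1) (b := 1)
    (f := fun x => w * (f x * Real.sin (w * x)) + f₁ x * Real.cos (w * x))
    (f' := fun x => w ^ 2 * (f x * Real.cos (w * x)) + f₂ x * Real.cos (w * x))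
    (by norm_num) (by fun_prop) (fun x hx => by
      have hw : HasDerivAt (fun x : ℝ => w * x) w x := by
        simpa using (hasDerivAt_id x).const_mul w
      refine ((((hd x hx).mul hw.sin).const_mul w).add ((hd₁ x hx).mul hw.cos)).congr_deriv ?_
      ring) ((hi.const_mul _).add hi2)
  rw [intervalIntegral.integral_add (hi.const_mul _) hi2, intervalIntegral.integral_const_mul]
    at key
  simp only [mul_one, mul_neg, Real.sin_neg, Real.cos_neg] at key
  rw [cosTransform, cosTransform]
  linarith

theorem mul_cosTransform {f f₁ : ℝ → ℝ} (hf : ContinuousOn f (Icc (-1) 1))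
    (hf₁ : ContinuousOn f₁ (Icc (-1) 1))
    (hd : ∀ x ∈ Ioo (-1 : ℝ) 1, HasDerivAt f (f₁ x) x) (w : ℝ) :
    w * cosTransform f w = Real.sin w * (f 1 + f (-1)) -
      ∫ x in (-1 : ℝ)..1, f₁ x * Real.sin (w * x) := by
  have hi : IntervalIntegrable (fun x => f x * Real.cos (w * x)) volume (-1) 1 :=
    (hf.mul (by fun_prop)).intervalIntegrable_neg_one_one
  have hi2 : IntervalIntegrable (fun x => f₁ x * Real.sin (w * x)) volume (-1) 1 :=
    (hf₁.mul (by fun_prop)).intervalIntegrable_neg_one_one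
  have key := intervalIntegral.integral_eq_sub_of_hasDerivAt_of_le (a := -1) (b := 1)
    (f := fun x => f x * Real.sin (w * x))
    (f' := fun x => w * (f x * Real.cos (w * x)) + f₁ x * Real.sin (w * x))
    (by norm_num) (by fun_prop) (fun x hx => by
      have hw : HasDerivAt (fun x : ℝ => w * x) w x := by
        simpa using (hasDerivAt_id x).const_mul w
      refine ((hd x hx).mul hw.sin).congr_deriv ?_
      ring) ((hi.const_mul _).add hi2)
  rw [intervalIntegral.integral_add (hi.const_mul _) hi2, intervalIntegral.integral_const_mul]
    at key
  simp only [mul_one, mul_neg, Real.sin_neg] at key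
  rw [cosTransform]
  linarith

theorem abs_intervalIntegral_le_of_abs_le {h : ℝ → ℝ} {C : ℝ}
    (hC : ∀ x ∈ Icc (-1 : ℝ) 1, |h x| ≤ C) : |∫ x in (-1 : ℝ)..1, h x| ≤ 2 * C := by
  have := intervalIntegral.norm_integral_le_of_norm_le_const (a := -1) (b := 1) (f := h) (C := C)
    (fun x hx => by
      rw [uIoc_of_le (by norm_num)] at hx
      exact hC x (Ioc_subset_Icc_self hx))
  rw [Real.norm_eq_abs] at this
  norm_num at this
  linarith

theorem ContinuousOn.exists_abs_le_neg_one_one {h : ℝ → ℝ} (hc : ContinuousOn h (Icc (-1) 1)) :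
    ∃ C, 0 ≤ C ∧ ∀ x ∈ Icc (-1 : ℝ) 1, |h x| ≤ C := by
  obtain ⟨C, hC⟩ := isCompact_Icc.exists_bound_of_continuousOn hc
  exact ⟨C, (norm_nonneg _).trans (hC 0 (by simp)), hC⟩

theorem exists_abs_mul_cosTransform_le {f f₁ : ℝ → ℝ} (hf : ContinuousOn f (Icc (-1) 1))
    (hf₁ : ContinuousOn f₁ (Icc (-1) 1))
    (hd : ∀ x ∈ Ioo (-1 : ℝ) 1, HasDerivAt f (f₁ x) x) :
    ∃ K, 0 ≤ K ∧ ∀ w, |w * cosTransform f w| ≤ K := by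
  obtain ⟨C, hC0, hC⟩ := hf₁.exists_abs_le_neg_one_one
  refine ⟨|f 1 + f (-1)| + 2 * C, by positivity, fun w => ?_⟩
  rw [mul_cosTransform hf hf₁ hd]
  refine (abs_sub _ _).trans (add_le_add ?_ (abs_intervalIntegral_le_of_abs_le fun x hx => ?_))
  · rw [abs_mul]
    exact mul_le_of_le_one_left (abs_nonneg _) (Real.abs_sin_le_one w)
  · rw [abs_mul]
    exact (mul_le_of_le_one_right (abs_nonneg _) (Real.abs_sin_le_one _)).trans (hC x hx)

theorem exists_cosTransform_lipschitz {f : ℝ → ℝ} (hf : ContinuousOn f (Icc (-1) 1)) :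
    ∃ L, 0 ≤ L ∧ ∀ w w', |cosTransform f w - cosTransform f w'| ≤ L * |w - w'| := by
  obtain ⟨C, hC0, hC⟩ := hf.exists_abs_le_neg_one_one
  refine ⟨2 * C, by positivity, fun w w' => ?_⟩
  have hi (v : ℝ) : IntervalIntegrable (fun x => f x * Real.cos (v * x)) volume (-1) 1 :=
    (hf.mul (by fun_prop)).intervalIntegrable_neg_one_one
  rw [cosTransform, cosTransform, ← intervalIntegral.integral_sub (hi w) (hi w'), mul_assoc]
  refine abs_intervalIntegral_le_of_abs_le fun x hx => ?_
  rw [← mul_sub, abs_mul]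
  refine mul_le_mul (hC x hx) ((Real.abs_cos_sub_cos_le _ _).trans ?_) (abs_nonneg _) hC0
  rw [← sub_mul, abs_mul]
  exact mul_le_of_le_one_right (abs_nonneg _) (abs_le.2 hx)

/-! ### Vanishing of the boundary terms. -/

theorem nonneg_of_forall_nat_mul {a K : ℝ} (h : ∀ n : ℕ, -K ≤ n * a) : 0 ≤ a := by
  by_contra! ha
  obtain ⟨n, hn⟩ := exists_nat_gt (K / -a)
  rw [div_lt_iff₀ (by linarith)] at hn
  have := h n
  nlinarith

/-- Sampling where `sin w = ±1`, `cos w = 0` isolates `±w a`, which cannot stay above the `O(1/w)`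
error unless `a = 0`. Sampling where `cos w = ±1` then does the same for `b`. -/
theorem eq_zero_of_oscillation_nonneg {a b K : ℝ} {e : ℝ → ℝ} (hK : ∀ w, |w * e w| ≤ K)
    (h : ∀ w, 0 ≤ w * Real.sin w * a + Real.cos w * b - e w) : a = 0 ∧ b = 0 := by
  have hπ := Real.pi_gt_three
  have ha0 : 0 ≤ a := by
    refine nonneg_of_forall_nat_mul (K := K) fun n => ?_
    by_contra! hn
    have h1 := h (Real.pi / 2 + n * (2 * Real.pi))
    have h2 := (abs_le.1 (hK (Real.pi / 2 + n * (2 * Real.pi)))).1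
    simp only [Real.sin_add_nat_mul_two_pi, Real.cos_add_nat_mul_two_pi, Real.sin_pi_div_two,
      Real.cos_pi_div_two] at h1
    set w := Real.pi / 2 + n * (2 * Real.pi) with hw
    have hn0 : (0 : ℝ) ≤ n := n.cast_nonneg
    have hwn : (n : ℝ) ≤ w ∧ 1 ≤ w := by constructor <;> nlinarith
    have hK0 := (abs_nonneg _).trans (hK 0)
    have hane : a < 0 := by by_contra! h0; nlinarith [mul_nonneg hn0 h0]
    have h3 : 0 ≤ w * (w * a - e w) := mul_nonneg (by linarith) (by linarith)
    have h4 : (n : ℝ) ≤ w * w := by nlinarith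
    nlinarith
  have ha1 : 0 ≤ -a := by
    refine nonneg_of_forall_nat_mul (K := K) fun n => ?_
    by_contra! hn
    have h1 := h (Real.pi / 2 + n * (2 * Real.pi) + Real.pi)
    have h2 := (abs_le.1 (hK (Real.pi / 2 + n * (2 * Real.pi) + Real.pi))).1
    simp only [Real.sin_add_pi, Real.cos_add_pi, Real.sin_add_nat_mul_two_pi,
      Real.cos_add_nat_mul_two_pi, Real.sin_pi_div_two, Real.cos_pi_div_two] at h1
    set w := Real.pi / 2 + n * (2 * Real.pi) + Real.pi with hw
    have hn0 : (0 : ℝ) ≤ n := n.cast_nonneg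
    have hwn : (n : ℝ) ≤ w ∧ 1 ≤ w := by constructor <;> nlinarith
    have hK0 := (abs_nonneg _).trans (hK 0)
    have hane : -a < 0 := by by_contra! h0; nlinarith [mul_nonneg hn0 h0]
    have h3 : 0 ≤ w * (w * -a - e w) := mul_nonneg (by linarith) (by linarith)
    have h4 : (n : ℝ) ≤ w * w := by nlinarith
    nlinarith
  have ha : a = 0 := by linarith
  subst ha
  refine ⟨rfl, le_antisymm ?_ ?_⟩
  · rw [← neg_nonneg]
    refine nonneg_of_forall_nat_mul (K := K) fun n => ?_
    have h1 := h (n * (2 * Real.pi) + Real.pi)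
    have h2 := (abs_le.1 (hK (n * (2 * Real.pi) + Real.pi))).1
    simp only [Real.cos_add_pi, Real.cos_nat_mul_two_pi] at h1
    by_contra! hn
    set w := n * (2 * Real.pi) + Real.pi with hw
    have hn0 : (0 : ℝ) ≤ n := n.cast_nonneg
    have hwn : (n : ℝ) ≤ w ∧ 1 ≤ w := by constructor <;> nlinarith
    have hK0 := (abs_nonneg _).trans (hK 0)
    have hbne : -b < 0 := by by_contra! h0; nlinarith [mul_nonneg hn0 h0]
    have h3 : 0 ≤ w * (-b - e w) := mul_nonneg (by linarith) (by linarith)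
    nlinarith
  · refine nonneg_of_forall_nat_mul (K := K) fun n => ?_
    have h1 := h (n * (2 * Real.pi))
    have h2 := (abs_le.1 (hK (n * (2 * Real.pi)))).1
    simp only [Real.cos_nat_mul_two_pi] at h1
    by_contra! hn
    set w := n * (2 * Real.pi) with hw
    have hn0 : (0 : ℝ) ≤ n := n.cast_nonneg
    have hwn : (n : ℝ) ≤ w := by nlinarith
    have hK0 := (abs_nonneg _).trans (hK 0)
    have hbne : b < 0 := by by_contra! h0; nlinarith [mul_nonneg hn0 h0]
    have h3 : 0 ≤ w * (b - e w) := mul_nonneg (by linarith) (by linarith)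
    nlinarith

theorem IsAdmissiblePerturbation.cosTransform_nonneg {f : ℝ → ℝ} (hf : IsAdmissiblePerturbation f)
    (w : ℝ) : 0 ≤ cosTransform f w := by
  have h := hf.fourier_re_nonneg (w / (2 * Real.pi))
  rw [fourier_ofReal_eq_cosTransform hf.even hf.support_subset hf.contDiffOn.continuousOn,
    Complex.ofReal_re, mul_div_cancel₀ _ (by positivity)] at h
  exact h

/-- The boundary values of an admissible perturbation vanish, and `w² ∫ f(x) cos(w x) dx` is
Lipschitz and decays at infinity. -/
theorem IsAdmissiblePerturbation.boundary_and_decay {f : ℝ → ℝ} (hf : IsAdmissiblePerturbation f) :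
    f 1 = 0 ∧ (∃ K, 0 ≤ K ∧ ∀ w, |w * (w ^ 2 * cosTransform f w)| ≤ K) ∧
      (∃ L, 0 ≤ L ∧ ∀ w w', |w ^ 2 * cosTransform f w - w' ^ 2 * cosTransform f w'| ≤
        L * |w - w'|) := by
  obtain ⟨f₁, hf₁, hd⟩ := ContDiffOn.exists_hasDerivAt_Ioo (n := 2) hf.contDiffOn
  obtain ⟨f₂, hf₂, hd₁⟩ := ContDiffOn.exists_hasDerivAt_Ioo (n := 1) hf₁
  obtain ⟨f₃, hf₃, hd₂⟩ := ContDiffOn.exists_hasDerivAt_Ioo (n := 0) hf₂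
  have hR := sq_mul_cosTransform hf.contDiffOn.continuousOn hf₁.continuousOn hf₂.continuousOn hd hd₁
  obtain ⟨K, hK0, hK⟩ := exists_abs_mul_cosTransform_le hf₂.continuousOn hf₃.continuousOn hd₂
  obtain ⟨L, hL0, hL⟩ := exists_cosTransform_lipschitz hf₂.continuousOn
  obtain ⟨ha, hb⟩ := eq_zero_of_oscillation_nonneg hK (fun w => (hR w).symm ▸
    mul_nonneg (sq_nonneg w) (hf.cosTransform_nonneg w))
  -- What remains is `w² F(w) = -∫ f'' cos(w x)`, which inherits the decay and Lipschitz bounds of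
  -- that transform.
  simp only [ha, hb, mul_zero, zero_add, zero_sub] at hR
  rw [hf.even] at ha
  refine ⟨by linarith, ⟨K, hK0, fun w => ?_⟩, ⟨L, hL0, fun w w' => ?_⟩⟩
  · rw [hR, mul_neg, abs_neg]; exact hK w
  · rw [hR, hR, neg_sub_neg, abs_sub_comm]; exact hL w w'

/-! ### Cosine series and positivity of the first variation. -/

/-- This is the Fourier series of the Bernoulli polynomial `B₂` at `(x + 1)/2`; the shift produces
`(-1)ⁿ`. Division by zero makes the `n = 0` term `0`, as it should be since `6x² - 2` has mean zero
on `[-1,1]`. -/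
theorem hasSum_neg_one_pow_mul_cos_div_sq {x : ℝ} (hx : x ∈ Icc (-1 : ℝ) 1) :
    HasSum (fun n : ℕ => 24 * (-1) ^ n / (Real.pi ^ 2 * n ^ 2) * Real.cos (Real.pi * n * x))
      (6 * x ^ 2 - 2) := by
  have h := hasSum_one_div_nat_pow_mul_cos one_ne_zero (x := (x + 1) / 2)
    ⟨by linarith [hx.1], by linarith [hx.2]⟩
  have hB : (Polynomial.map (algebraMap ℚ ℝ) (Polynomial.bernoulli (2 * 1))).eval ((x + 1) / 2) =
      (x ^ 2 - 1) / 4 + 1 / 6 := by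
    rw [mul_one, Polynomial.bernoulli_def]
    simp [Finset.sum_range_succ, bernoulli_eq_bernoulli'_of_ne_one, bernoulli_one]
    ring
  rw [hB] at h
  convert! h.mul_left (24 / Real.pi ^ 2) using 1
  · ext n
    have : Real.cos (2 * Real.pi * n * ((x + 1) / 2)) = (-1) ^ n * Real.cos (Real.pi * n * x) := by
      rw [show 2 * Real.pi * n * ((x + 1) / 2) = Real.pi * n * x + n * Real.pi by ring,
        Real.cos_add_nat_mul_pi]
    rw [this]
    simp only [mul_one]
    field_simp
  · have := Real.pi_ne_zero
    norm_num
    field_simp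
    ring

theorem hasSum_cosTransform {f : ℝ → ℝ} (hf : ContinuousOn f (Icc (-1) 1)) :
    HasSum (fun n : ℕ => 24 * (-1) ^ n / (Real.pi ^ 2 * n ^ 2) * cosTransform f (Real.pi * n))
      (∫ x in (-1 : ℝ)..1, f x * (6 * x ^ 2 - 2)) := by
  obtain ⟨C, hC0, hC⟩ := hf.exists_abs_le_neg_one_one
  have hsumm : Summable fun n : ℕ => 24 / Real.pi ^ 2 * C * (1 / (n : ℝ) ^ 2) :=
    (Real.summable_one_div_nat_pow.2 one_lt_two).mul_left _
  have h := intervalIntegral.hasSum_integral_of_dominated_convergence (μ := volume) (a := -1)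
    (b := 1) (ι := ℕ)
    (F := fun n x => 24 * (-1) ^ n / (Real.pi ^ 2 * n ^ 2) * (f x * Real.cos (Real.pi * n * x)))
    (f := fun x => f x * (6 * x ^ 2 - 2))
    (fun n _ => 24 / Real.pi ^ 2 * C * (1 / (n : ℝ) ^ 2)) (fun n => ?_)
    (fun n => ae_of_all _ fun x hx => ?_) (ae_of_all _ fun _ _ => hsumm) ?_
    (ae_of_all _ fun x hx => ?_)
  · simpa only [intervalIntegral.integral_const_mul] using! h
  · rw [uIoc_of_le (by norm_num)]
    refine ContinuousOn.aestronglyMeasurable (continuousOn_const.mul ?_) measurableSet_Ioc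
    exact (hf.mono Ioc_subset_Icc_self).mul (by fun_prop)
  · rw [uIoc_of_le (by norm_num)] at hx
    have h1 := hC x (Ioc_subset_Icc_self hx)
    have h2 : |f x * Real.cos (Real.pi * n * x)| ≤ C := by
      rw [abs_mul]
      exact (mul_le_of_le_one_right (abs_nonneg _) (Real.abs_cos_le_one _)).trans h1
    rw [Real.norm_eq_abs, abs_mul]
    have h3 : |24 * (-1) ^ n / (Real.pi ^ 2 * n ^ 2)| = 24 / Real.pi ^ 2 * (1 / (n : ℝ) ^ 2) := by
      rw [abs_div, abs_mul, abs_pow, abs_neg, abs_one, one_pow, abs_of_nonneg (by positivity),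
        abs_of_nonneg (by positivity)]
      field_simp
    rw [h3]
    calc _ ≤ 24 / Real.pi ^ 2 * (1 / (n : ℝ) ^ 2) * C := by gcongr
      _ = _ := by ring
  · simp
  · rw [uIoc_of_le (by norm_num)] at hx
    convert! (hasSum_neg_one_pow_mul_cos_div_sq (Ioc_subset_Icc_self hx)).mul_left (f x) using 2
    ring

theorem hasSum_one_sub_neg_one_pow_div_pow_four :
    HasSum (fun n : ℕ => (1 - (-1) ^ n) / 2 * (1 / (n : ℝ) ^ 4)) (Real.pi ^ 4 / 96) := by
  have h := hasSum_zeta_four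
  have h2 : HasSum (fun n : ℕ => (1 : ℝ) / ((2 * n : ℕ) : ℝ) ^ 4) (Real.pi ^ 4 / 90 / 16) := by
    convert! h.div_const 16 using 2 with n
    push_cast
    rw [mul_pow, div_div, mul_comm]; norm_num
  have hodd : Summable fun n : ℕ => (1 : ℝ) / ((2 * n + 1 : ℕ) : ℝ) ^ 4 :=
    h.summable.comp_injective (i := fun n : ℕ => 2 * n + 1) fun a b hab => by simpa using hab
  have h3 := HasSum.even_add_odd (f := fun n : ℕ => (1 : ℝ) / (n : ℝ) ^ 4) h2 hodd.hasSum
  have h4 := h3.unique h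
  have h5 : HasSum (fun n : ℕ => (1 - (-1 : ℝ) ^ (2 * n)) / 2 * (1 / ((2 * n : ℕ) : ℝ) ^ 4)) 0 := by
    convert! (hasSum_zero : HasSum (fun _ : ℕ => (0 : ℝ)) 0) using 2 with n
    rw [pow_mul, neg_one_sq, one_pow, sub_self, zero_div, zero_mul]
  have h6 : HasSum
      (fun n : ℕ => (1 - (-1 : ℝ) ^ (2 * n + 1)) / 2 * (1 / ((2 * n + 1 : ℕ) : ℝ) ^ 4))
      (Real.pi ^ 4 / 96) := by
    have : ∑' n : ℕ, (1 : ℝ) / ((2 * n + 1 : ℕ) : ℝ) ^ 4 = Real.pi ^ 4 / 96 := by linarith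
    rw [← this]
    convert! hodd.hasSum using 2 with n
    rw [pow_succ, pow_mul, neg_one_sq, one_pow, one_mul, sub_neg_eq_add, one_add_one_eq_two,
      div_self two_ne_zero, one_mul]
  have h7 := HasSum.even_add_odd
    (f := fun n : ℕ => (1 - (-1 : ℝ) ^ n) / 2 * (1 / (n : ℝ) ^ 4)) h5 h6
  rwa [zero_add] at h7

/-- An even continuous function on `[-1,1]` whose nonconstant cosine coefficients vanish is
constant. -/
theorem eq_const_of_cosTransform_eq_zero {f : ℝ → ℝ} (heven : ∀ x, f (-x) = f x)
    (hf : ContinuousOn f (Icc (-1) 1)) (h0 : ∀ n : ℕ, n ≠ 0 → cosTransform f (Real.pi * n) = 0)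
    {x y : ℝ} (hx : x ∈ Icc (-1 : ℝ) 1) (hy : y ∈ Icc (-1 : ℝ) 1) : f x = f y := by
  have : Fact ((0 : ℝ) < 2) := ⟨two_pos⟩
  let F : ℝ → ℂ := fun x => (f x : ℂ)
  have hend : (-1 : ℝ) + 2 = 1 := by norm_num
  have hFc : ContinuousOn F (Icc (-1) 1) := Complex.continuous_ofReal.comp_continuousOn hf
  -- Evenness makes the endpoint values agree, so the 2-periodic extension is continuous. Its
  -- Fourier series has at most one nonzero term, hence converges to it pointwise.
  have hcont : Continuous (AddCircle.liftIco (2 : ℝ) (-1) F) :=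
    AddCircle.liftIco_continuous (by simp [F, hend, heven]) (by rwa [hend])
  let φ : C(AddCircle (2 : ℝ), ℂ) := ⟨_, hcont⟩
  have hcos (n : ℤ) (hn : n ≠ 0) : cosTransform f (Real.pi * n) = 0 := by
    have h1 := h0 n.natAbs (by simpa using hn)
    rcases Int.natAbs_eq n with h | h
    · rw [h]; simpa using h1
    · rw [h, ← h1]; simp [cosTransform]
  have hcoeff (n : ℤ) (hn : n ≠ 0) : fourierCoeff φ n = 0 := by
    have h2 := fourierCoeff_liftIco_eq (T := (2 : ℝ)) (a := -1) F n
    refine h2.trans ?_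
    rw [fourierCoeffOn_eq_integral]
    have h3 : ∫ x in (-1 : ℝ)..(-1 + 2), fourier (-n) (x : AddCircle (-1 + 2 - -1 : ℝ)) • F x =
        0 := by
      have : ∀ x : ℝ, fourier (-n) (x : AddCircle (-1 + 2 - -1 : ℝ)) • F x =
          ((f x * Real.cos (Real.pi * n * x) : ℝ) : ℂ) -
            Complex.I * ((f x * Real.sin (Real.pi * n * x) : ℝ) : ℂ) := by
        intro x
        rw [fourier_coe_apply, show (2 * Real.pi * Complex.I * (-n : ℤ) * x /
          ((-1 + 2 - -1 : ℝ) : ℂ)) = ((-(Real.pi * n * x) : ℝ) : ℂ) * Complex.I by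
            push_cast; ring, Complex.exp_mul_I,
          ← Complex.ofReal_cos, ← Complex.ofReal_sin, Real.cos_neg, Real.sin_neg, smul_eq_mul]
        push_cast; ring
      rw [intervalIntegral.integral_congr fun x _ => this x, hend, integral_cos_sub_I_mul_sin heven hf,
        hcos n hn, Complex.ofReal_zero]
    rw [h3, smul_zero]
  have hsummable : Summable (fourierCoeff φ) :=
    summable_of_ne_finset_zero (s := {0}) fun n hn => hcoeff n (by simpa using hn)
  have hval (z : AddCircle (2 : ℝ)) : φ z = fourierCoeff φ 0 := by
    refine (has_pointwise_sum_fourier_series_of_summable hsummable z).unique ?_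
    convert! hasSum_single (α := ℂ) (0 : ℤ) (f := fun i => fourierCoeff φ i • fourier i z) ?_
    · simp
    · intro n hn; simp [hcoeff n hn]
  have hconst (x : ℝ) (hx : x ∈ Ico (-1 : ℝ) 1) : (f x : ℂ) = fourierCoeff φ 0 := by
    rw [← hval (x : AddCircle (2 : ℝ))]
    exact (AddCircle.liftIco_coe_apply (f := F) (p := 2) (a := -1) (by rwa [hend])).symm
  have hconst' (x : ℝ) (hx : x ∈ Icc (-1 : ℝ) 1) : (f x : ℂ) = fourierCoeff φ 0 := by
    rcases hx.2.lt_or_eq with h | rfl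
    · exact hconst x ⟨hx.1, h⟩
    · rw [← heven]; exact hconst _ (by norm_num)
  exact_mod_cast (hconst' x hx).trans (hconst' y hy).symm

/-- Writing `G/4` as `∑ 24 G/(πn)⁴` over odd `n` matches it term by term with the cosine expansion
of the integral, and every combined term is nonnegative. -/
theorem IsAdmissiblePerturbation.moment_positivity {f : ℝ → ℝ} (hf : IsAdmissiblePerturbation f)
    (hne : f ≠ 0) {G : ℝ} (hG : ∀ n : ℕ, Odd n →
      (Real.pi * n) ^ 2 * cosTransform f (Real.pi * n) ≤ G) :
    0 < G / 4 + ∫ x in (-1 : ℝ)..1, f x * (6 * x ^ 2 - 2) := by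
  obtain ⟨hf1, ⟨K, hK0, hK⟩, -⟩ := hf.boundary_and_decay
  have hc := hf.contDiffOn.continuousOn
  have hπ := Real.pi_pos
  have hsum := (hasSum_one_sub_neg_one_pow_div_pow_four.mul_left (24 * G / Real.pi ^ 4)).add
    (hasSum_cosTransform hc)
  rw [show 24 * G / Real.pi ^ 4 * (Real.pi ^ 4 / 96) = G / 4 by field_simp; ring] at hsum
  set ψ : ℕ → ℝ := fun n => (Real.pi * n) ^ 2 * cosTransform f (Real.pi * n) with hψ
  have hψ0 (n : ℕ) : 0 ≤ ψ n := mul_nonneg (sq_nonneg _) (hf.cosTransform_nonneg _)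
  have hterm (n : ℕ) : 24 * G / Real.pi ^ 4 * ((1 - (-1) ^ n) / 2 * (1 / (n : ℝ) ^ 4)) +
      24 * (-1) ^ n / (Real.pi ^ 2 * n ^ 2) * cosTransform f (Real.pi * n) =
      24 / (Real.pi ^ 4 * n ^ 4) * ((1 - (-1) ^ n) / 2 * G + (-1) ^ n * ψ n) := by
    rcases eq_or_ne n 0 with rfl | hn
    · simp
    · simp only [hψ]; field_simp
  simp_rw [hterm] at hsum
  have hnn (n : ℕ) : 0 ≤ (1 - (-1) ^ n) / 2 * G + (-1) ^ n * ψ n := by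
    rcases n.even_or_odd with h | h
    · rw [h.neg_one_pow]; linarith [hψ0 n]
    · rw [h.neg_one_pow]; linarith [hG n h]
  have hnn' (n : ℕ) : 0 ≤ 24 / (Real.pi ^ 4 * n ^ 4) *
      ((1 - (-1) ^ n) / 2 * G + (-1) ^ n * ψ n) := mul_nonneg (by positivity) (hnn n)
  refine (hsum.nonneg hnn').lt_of_ne fun heq => hne ?_
  rw [← heq, hasSum_zero_iff_of_nonneg hnn'] at hsum
  have hz (n : ℕ) (hn : n ≠ 0) : (1 - (-1) ^ n) / 2 * G + (-1) ^ n * ψ n = 0 := by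
    have h1 := congrFun hsum n
    simp only [Pi.zero_apply, mul_eq_zero] at h1
    refine h1.resolve_left ?_
    positivity
  have hGodd (n : ℕ) (hn : Odd n) : ψ n = G := by
    have h1 := hz n hn.pos.ne'
    rw [hn.neg_one_pow] at h1; linarith
  have hGeven (n : ℕ) (hn0 : n ≠ 0) (hn : Even n) : ψ n = 0 := by
    have h1 := hz n hn0
    rw [hn.neg_one_pow] at h1; linarith
  -- In the equality case `ψ` equals `G` at every odd `n`, which its `O(1/w)` decay excludes for `G
  -- > 0`.
  have hG0 : G ≤ 0 := by
    rw [← neg_nonneg]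
    refine nonneg_of_forall_nat_mul (K := K) fun n => ?_
    have h1 := (abs_le.1 (hK (Real.pi * (2 * n + 1 : ℕ)))).2
    have h2 := hGodd (2 * n + 1) ⟨n, rfl⟩
    simp only [hψ] at h2
    rw [h2] at h1
    have h3 : 0 ≤ G := (hψ0 1).trans_eq (hGodd 1 odd_one)
    have h4 : (n : ℝ) ≤ Real.pi * (2 * n + 1 : ℕ) := by
      push_cast; nlinarith [Real.pi_gt_three, (Nat.cast_nonneg n : (0 : ℝ) ≤ n)]
    nlinarith
  have hcz (n : ℕ) (hn : n ≠ 0) : cosTransform f (Real.pi * n) = 0 := by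
    have h1 : ψ n = 0 := by
      rcases n.even_or_odd with h | h
      · exact hGeven n hn h
      · exact le_antisymm ((hGodd n h).trans_le hG0) (hψ0 n)
    refine (mul_eq_zero.1 h1).resolve_left ?_
    positivity
  ext x
  by_cases hx : x ∈ Icc (-1 : ℝ) 1
  · exact (eq_const_of_cosTransform_eq_zero hf.even hc hcz hx (by simp)).trans hf1
  · exact Function.notMem_support.1 fun h => hx (hf.support_subset h)

/-! ### Two analytic tools, and the triangle function. -/

theorem ofReal_le_eLpNormEssSup {q : ℝ → ℝ} (hq : Continuous q) (h0 : ∀ y, 0 ≤ q y) (y : ℝ) :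
    ENNReal.ofReal (q y) ≤ eLpNormEssSup q volume := by
  by_contra! hlt
  have hopen : IsOpen {z | eLpNormEssSup q volume < ENNReal.ofReal (q z)} :=
    isOpen_lt continuous_const (ENNReal.continuous_ofReal.comp hq)
  refine hopen.measure_ne_zero volume ⟨y, hlt⟩ ?_
  have := ae_le_eLpNormEssSup (f := q) (μ := volume)
  rw [ae_iff] at this
  refine measure_mono_null (fun z hz => ?_) this
  simpa [Real.enorm_of_nonneg (h0 z)] using! hz

theorem hasDerivWithinAt_Ici_zero_of_quadratic_error {S : ℝ → ℝ} {a b C : ℝ}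
    (hl : ∀ ε, 0 ≤ ε → a + ε * b ≤ S ε) (hu : ∀ ε, 0 ≤ ε → S ε ≤ a + ε * b + C * ε ^ 2) :
    HasDerivWithinAt S b (Ici 0) 0 := by
  have h0 : S 0 = a := le_antisymm (by simpa using hu 0 le_rfl) (by simpa using hl 0 le_rfl)
  rw [hasDerivWithinAt_iff_isLittleO]
  have hO : (fun ε : ℝ => S ε - S 0 - (ε - 0) • b) =O[𝓝[Ici 0] 0] fun ε => ε ^ 2 := by
    refine Asymptotics.IsBigO.of_bound C ?_
    filter_upwards [self_mem_nhdsWithin] with ε (hε : 0 ≤ ε)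
    rw [h0, sub_zero, smul_eq_mul, Real.norm_of_nonneg (by linarith [hl ε hε]),
      Real.norm_of_nonneg (sq_nonneg ε)]
    linarith [hu ε hε]
  refine hO.trans_isLittleO ?_
  simpa using (Asymptotics.isLittleO_pow_id (one_lt_two)).mono nhdsWithin_le_nhds

theorem continuous_triangleFun : Continuous triangleFun := by
  unfold triangleFun; fun_prop

theorem triangleFun_neg (x : ℝ) : triangleFun (-x) = triangleFun x := by
  simp [triangleFun]

theorem support_triangleFun_subset : Function.support triangleFun ⊆ Icc (-1) 1 := by
  intro x hx
  rw [mem_Icc, ← abs_le]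
  by_contra! h
  exact hx (max_eq_right (by linarith))

theorem intervalIntegral_even_eq_two_mul {h : ℝ → ℝ} (heven : ∀ x, h (-x) = h x)
    (hc : Continuous h) : ∫ x in (-1 : ℝ)..1, h x = 2 * ∫ x in (0 : ℝ)..1, h x := by
  have h1 := intervalIntegral.integral_comp_neg (a := 0) (b := 1) h
  simp only [heven, neg_zero] at h1
  rw [← intervalIntegral.integral_add_adjacent_intervals (b := 0) (hc.intervalIntegrable _ _)
    (hc.intervalIntegrable _ _), ← h1]
  ring

theorem triangleFun_of_mem {x : ℝ} (hx : x ∈ uIcc (0 : ℝ) 1) : triangleFun x = 1 - x := by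
  rw [uIcc_of_le zero_le_one] at hx
  rw [triangleFun, abs_of_nonneg hx.1, max_eq_left (by linarith [hx.2])]

theorem sq_mul_cosTransform_triangleFun (w : ℝ) :
    w ^ 2 * cosTransform triangleFun w = 2 * (1 - Real.cos w) := by
  have hcont : Continuous fun x => triangleFun x * Real.cos (w * x) :=
    continuous_triangleFun.mul (by fun_prop)
  have h1 : ∫ x in (0 : ℝ)..1, triangleFun x * Real.cos (w * x) =
      ∫ x in (0 : ℝ)..1, (1 - x) * Real.cos (w * x) :=
    intervalIntegral.integral_congr fun x hx => by simp only [triangleFun_of_mem hx]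
  have key := intervalIntegral.integral_eq_sub_of_hasDerivAt (a := 0) (b := 1)
    (f := fun x => w * ((1 - x) * Real.sin (w * x)) - Real.cos (w * x))
    (f' := fun x => w ^ 2 * ((1 - x) * Real.cos (w * x)))
    (fun x _ => by
      have hw : HasDerivAt (fun x : ℝ => w * x) w x := by
        simpa using (hasDerivAt_id x).const_mul w
      refine (((((hasDerivAt_id x).const_sub 1).mul hw.sin).const_mul w).sub hw.cos).congr_deriv ?_
      simp only [id]
      ring) (Continuous.intervalIntegrable (by fun_prop) _ _)
  rw [intervalIntegral.integral_const_mul] at key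
  rw [cosTransform, intervalIntegral_even_eq_two_mul (by simp [triangleFun_neg]) hcont, h1]
  simp at key
  linarith

theorem integral_triangleFun : ∫ x in (-1 : ℝ)..1, triangleFun x = 1 := by
  rw [intervalIntegral_even_eq_two_mul triangleFun_neg continuous_triangleFun,
    intervalIntegral.integral_congr fun x hx => triangleFun_of_mem hx,
    intervalIntegral.integral_sub (by simp) (by simp)]
  norm_num

theorem integral_triangleFun_mul_sq : ∫ x in (-1 : ℝ)..1, triangleFun x * x ^ 2 = 1 / 6 := by
  have h1 : ∫ x in (0 : ℝ)..1, triangleFun x * x ^ 2 = ∫ x in (0 : ℝ)..1, (x ^ 2 - x ^ 3) :=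
    intervalIntegral.integral_congr fun x hx => by
      simp only [triangleFun_of_mem hx]; ring
  have hcont : Continuous fun x => triangleFun x * x ^ 2 :=
    continuous_triangleFun.mul (by fun_prop)
  rw [intervalIntegral_even_eq_two_mul (by simp [triangleFun_neg]) hcont, h1,
    intervalIntegral.integral_sub (by simp) (by simp)]
  norm_num

/-- A Lipschitz function vanishing at the endpoints is controlled by the distance `1 - |x|` to them.
This keeps `u₀ + εf` nonnegative for small `ε`, so the absolute values in the `L¹` norms can be
dropped. -/
theorem IsAdmissiblePerturbation.exists_abs_le_mul {f : ℝ → ℝ} (hf : IsAdmissiblePerturbation f) :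
    ∃ C, 0 ≤ C ∧ ∀ x, |f x| ≤ C * triangleFun x := by
  have hf1 := hf.boundary_and_decay.1
  obtain ⟨C, hC⟩ := hf.contDiffOn.exists_lipschitzOnWith (by simp) (convex_Icc _ _) isCompact_Icc
  refine ⟨C, C.2, fun x => ?_⟩
  by_cases hx : x ∈ Icc (-1 : ℝ) 1
  · have habs : |x| ∈ Icc (-1 : ℝ) 1 := ⟨by linarith [abs_nonneg x], abs_le.2 hx⟩
    have h1 := hC.dist_le_mul |x| habs 1 (by simp)
    have hfx : f |x| = f x := by
      rcases abs_choice x with h | h <;> rw [h]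
      exact hf.even x
    rw [Real.dist_eq, Real.dist_eq, hf1, sub_zero, hfx, abs_sub_comm,
      abs_of_nonneg (a := 1 - |x|) (by linarith [habs.2])] at h1
    rwa [triangleFun, max_eq_left (by linarith [habs.2])]
  · rw [Function.notMem_support.1 fun h => hx (hf.support_subset h), abs_zero]
    exact mul_nonneg C.2 (le_max_right _ _)

/-! ### Norms of the perturbed triangle. -/

section Perturbed

variable {f : ℝ → ℝ} {ε : ℝ}

theorem perturbed_neg (hf : IsAdmissiblePerturbation f) (x : ℝ) :
    triangleFun (-x) + ε * f (-x) = triangleFun x + ε * f x := by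
  rw [triangleFun_neg, hf.even]

theorem perturbed_support_subset (hf : IsAdmissiblePerturbation f) :
    Function.support (fun x => triangleFun x + ε * f x) ⊆ Icc (-1) 1 := by
  intro x hx
  by_contra h
  refine hx ?_
  simp only
  rw [Function.notMem_support.1 fun h' => h (hf.support_subset h'),
    Function.notMem_support.1 fun h' => h (support_triangleFun_subset h'), mul_zero, add_zero]

theorem perturbed_continuousOn (hf : IsAdmissiblePerturbation f) :
    ContinuousOn (fun x => triangleFun x + ε * f x) (Icc (-1) 1) :=
  continuous_triangleFun.continuousOn.add (hf.contDiffOn.continuousOn.const_mul ε)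

theorem integrable_perturbed (hf : IsAdmissiblePerturbation f) :
    Integrable (fun x => triangleFun x + ε * f x) := by
  rw [← integrableOn_iff_integrable_of_support_subset (perturbed_support_subset hf)]
  exact (perturbed_continuousOn hf).integrableOn_compact isCompact_Icc

theorem sq_mul_cosTransform_perturbed (hf : IsAdmissiblePerturbation f) (w : ℝ) :
    w ^ 2 * cosTransform (fun x => triangleFun x + ε * f x) w =
      2 * (1 - Real.cos w) + ε * (w ^ 2 * cosTransform f w) := by
  have h1 : IntervalIntegrable (fun x => triangleFun x * Real.cos (w * x)) volume (-1) 1 :=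
    (continuous_triangleFun.mul (by fun_prop)).intervalIntegrable _ _
  have h2 : IntervalIntegrable (fun x => f x * Real.cos (w * x)) volume (-1) 1 :=
    (hf.contDiffOn.continuousOn.mul (by fun_prop)).intervalIntegrable_neg_one_one
  have h3 : cosTransform (fun x => triangleFun x + ε * f x) w =
      cosTransform triangleFun w + ε * cosTransform f w := by
    simp only [cosTransform, add_mul, mul_assoc]
    rw [intervalIntegral.integral_add h1 (h2.const_mul ε), intervalIntegral.integral_const_mul]
  rw [h3, ← sq_mul_cosTransform_triangleFun]
  ring

theorem norm_fourier_perturbed_mul_sq (hf : IsAdmissiblePerturbation f) (hε : 0 ≤ ε) (ξ : ℝ) :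
    ‖𝓕 (perturbedTriangle f ε) ξ‖ * ξ ^ 2 =
      (2 * (1 - Real.cos (2 * Real.pi * ξ)) +
        ε * ((2 * Real.pi * ξ) ^ 2 * cosTransform f (2 * Real.pi * ξ))) / (4 * Real.pi ^ 2) := by
  have h1 : 𝓕 (perturbedTriangle f ε) ξ =
      (cosTransform (fun x => triangleFun x + ε * f x) (2 * Real.pi * ξ) : ℂ) :=
    fourier_ofReal_eq_cosTransform (h := fun x => triangleFun x + ε * f x) (perturbed_neg hf)
      (perturbed_support_subset hf) (perturbed_continuousOn hf) ξ
  have h2 := sq_mul_cosTransform_perturbed (ε := ε) hf (2 * Real.pi * ξ)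
  have h3 : 0 ≤ 2 * (1 - Real.cos (2 * Real.pi * ξ)) +
        ε * ((2 * Real.pi * ξ) ^ 2 * cosTransform f (2 * Real.pi * ξ)) :=
    add_nonneg (by linarith [Real.cos_le_one (2 * Real.pi * ξ)])
      (mul_nonneg hε (mul_nonneg (sq_nonneg _) (hf.cosTransform_nonneg _)))
  rw [h1, Complex.norm_real, Real.norm_eq_abs, eq_div_iff (by positivity), ← abs_of_nonneg h3, ← h2,
    abs_mul, abs_of_nonneg (sq_nonneg (2 * Real.pi * ξ))]
  ring

/-- The supremum of the values of `w² ∫ f(x) cos(w x) dx` over the odd multiples of `π`. -/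
noncomputable def oddSup (f : ℝ → ℝ) : ℝ :=
  ⨆ k : ℤ, ((2 * k + 1) * Real.pi) ^ 2 * cosTransform f ((2 * k + 1) * Real.pi)

theorem IsAdmissiblePerturbation.le_oddSup (hf : IsAdmissiblePerturbation f) (k : ℤ) :
    ((2 * k + 1) * Real.pi) ^ 2 * cosTransform f ((2 * k + 1) * Real.pi) ≤ oddSup f := by
  -- The real supremum is meaningful only for a bounded family; here `|w| ≥ 1` turns the decay bound
  -- into a uniform one.
  obtain ⟨-, ⟨K, hK0, hK⟩, -⟩ := hf.boundary_and_decay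
  refine le_ciSup (f := fun k : ℤ =>
    ((2 * k + 1) * Real.pi) ^ 2 * cosTransform f ((2 * k + 1) * Real.pi)) ⟨K, ?_⟩ k
  rintro _ ⟨j, rfl⟩
  have h1 := hK ((2 * j + 1) * Real.pi)
  have h2 : (1 : ℝ) ≤ |(2 * j + 1) * Real.pi| := by
    have h3 : (1 : ℝ) ≤ |(2 * j + 1 : ℝ)| := by
      have : (1 : ℤ) ≤ |2 * j + 1| := Int.one_le_abs (by omega)
      exact_mod_cast this
    rw [abs_mul, abs_of_pos Real.pi_pos]
    nlinarith [Real.pi_gt_three]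
  rw [abs_mul] at h1
  refine (le_abs_self _).trans (le_trans ?_ h1)
  exact le_mul_of_one_le_left (abs_nonneg _) h2

/-- Evaluation at the half-integers gives the lower bound. Moving a distance `t` in `w` away from a
peak gains at most `ε L |t|` but costs at least `4t²/π²`, so the net gain is quadratic in `ε`. -/
theorem fourierSecondMomentSup_perturbed_bounds (hf : IsAdmissiblePerturbation f) :
    ∃ C, ∀ ε, 0 ≤ ε → fourierSecondMomentSup (perturbedTriangle f ε) ≠ ∞ ∧
      1 / Real.pi ^ 2 + ε * (oddSup f / (4 * Real.pi ^ 2)) ≤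
        (fourierSecondMomentSup (perturbedTriangle f ε)).toReal ∧
      (fourierSecondMomentSup (perturbedTriangle f ε)).toReal ≤
        1 / Real.pi ^ 2 + ε * (oddSup f / (4 * Real.pi ^ 2)) + C * ε ^ 2 := by
  obtain ⟨-, -, ⟨L, hL0, hL⟩⟩ := hf.boundary_and_decay
  have hπ := Real.pi_pos
  -- The maximum of `ε L |t| - 4t²/π²` is `ε² L² π²/16`; dividing by `4π²` gives this constant.
  refine ⟨L ^ 2 / 64, fun ε hε => ?_⟩
  set q : ℝ → ℝ := fun ξ => ‖𝓕 (perturbedTriangle f ε) ξ‖ * ξ ^ 2 with hq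
  have hqc : Continuous q := by
    have : Integrable (perturbedTriangle f ε) := (integrable_perturbed hf).ofReal
    exact (fourier_continuous_of_integrable this).norm.mul (by fun_prop)
  have hq0 (ξ : ℝ) : 0 ≤ q ξ := by positivity
  have hodd (k : ℤ) : Real.cos ((2 * k + 1) * Real.pi) = -1 := by
    rw [show (2 * k + 1) * Real.pi = Real.pi + k * (2 * Real.pi) by ring,
      Real.cos_add_int_mul_two_pi, Real.cos_pi]
  have hG0 : 0 ≤ oddSup f :=
    (mul_nonneg (sq_nonneg _) (hf.cosTransform_nonneg _)).trans (hf.le_oddSup 0)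
  have hupper (ξ : ℝ) : q ξ ≤
      1 / Real.pi ^ 2 + ε * (oddSup f / (4 * Real.pi ^ 2)) + L ^ 2 / 64 * ε ^ 2 := by
    rw [hq]
    simp only
    rw [norm_fourier_perturbed_mul_sq hf hε]
    set w := 2 * Real.pi * ξ with hw
    set k := ⌊ξ⌋
    set t := w - (2 * k + 1) * Real.pi with ht
    have ht1 : |t| ≤ Real.pi := by
      have h1 := Int.floor_le ξ
      have h2 := Int.lt_floor_add_one ξ
      rw [abs_le]
      constructor <;> nlinarith
    have hcos : Real.cos w = -Real.cos t := by
      rw [show w = t + Real.pi + k * (2 * Real.pi) by rw [ht]; ring,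
        Real.cos_add_int_mul_two_pi, Real.cos_add_pi]
    have hquad := Real.cos_le_one_sub_mul_cos_sq ht1
    have hlip := (abs_le.1 (hL w ((2 * k + 1) * Real.pi))).2
    have hle := hf.le_oddSup k
    rw [← ht] at hlip
    have hψ : ε * (w ^ 2 * cosTransform f w) ≤ ε * (oddSup f + L * |t|) := by
      gcongr; linarith
    have hsq : 0 ≤ (2 / Real.pi * |t| - ε * L * Real.pi / 4) ^ 2 := sq_nonneg _
    have hsq' : ε * L * |t| ≤ 4 / Real.pi ^ 2 * t ^ 2 + ε ^ 2 * L ^ 2 * Real.pi ^ 2 / 16 := by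
      have : (2 / Real.pi * |t| - ε * L * Real.pi / 4) ^ 2 =
          4 / Real.pi ^ 2 * |t| ^ 2 + ε ^ 2 * L ^ 2 * Real.pi ^ 2 / 16 - ε * L * |t| := by
        field_simp; ring
      rw [this, sq_abs] at hsq
      linarith
    rw [div_le_iff₀ (by positivity), hcos]
    have hexp : (1 / Real.pi ^ 2 + ε * (oddSup f / (4 * Real.pi ^ 2)) + L ^ 2 / 64 * ε ^ 2) *
        (4 * Real.pi ^ 2) = 4 + ε * oddSup f + ε ^ 2 * L ^ 2 * Real.pi ^ 2 / 16 := by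
      field_simp; ring
    rw [hexp]
    have : 2 / Real.pi ^ 2 * t ^ 2 * 2 = 4 / Real.pi ^ 2 * t ^ 2 := by ring
    linarith
  have hle : eLpNormEssSup q volume ≤ ENNReal.ofReal
      (1 / Real.pi ^ 2 + ε * (oddSup f / (4 * Real.pi ^ 2)) + L ^ 2 / 64 * ε ^ 2) := by
    refine eLpNormEssSup_le_of_ae_enorm_bound (ae_of_all _ fun ξ => ?_)
    rw [Real.enorm_of_nonneg (hq0 ξ)]
    exact ENNReal.ofReal_le_ofReal (hupper ξ)
  rw [fourierSecondMomentSup_eq]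
  have hfin : eLpNormEssSup q volume ≠ ∞ := ne_top_of_le_ne_top ENNReal.ofReal_ne_top hle
  have hlow (k : ℤ) : 1 / Real.pi ^ 2 + ε * ((((2 * k + 1) * Real.pi) ^ 2 *
      cosTransform f ((2 * k + 1) * Real.pi)) / (4 * Real.pi ^ 2)) ≤
        (eLpNormEssSup q volume).toReal := by
    have h1 := ofReal_le_eLpNormEssSup hqc hq0 (k + 1 / 2)
    rw [ENNReal.ofReal_le_iff_le_toReal hfin] at h1
    refine le_trans (le_of_eq ?_) h1
    rw [hq]
    simp only
    rw [norm_fourier_perturbed_mul_sq hf hε,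
      show 2 * Real.pi * ((k : ℝ) + 1 / 2) = (2 * k + 1) * Real.pi by ring, hodd]
    field_simp
    ring
  refine ⟨hfin, ?_, ENNReal.toReal_le_of_le_ofReal (by positivity) hle⟩
  -- Passing to the supremum over `k` requires dividing by `ε`, so `ε = 0` is separate.
  rcases hε.eq_or_lt with rfl | hpos
  · simpa using hlow 0
  · rw [← le_sub_iff_add_le', ← le_div_iff₀' hpos, div_le_iff₀ (by positivity)]
    refine ciSup_le fun k => ?_
    rw [← div_le_iff₀ (by positivity), le_div_iff₀' hpos, le_sub_iff_add_le']
    exact hlow k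

theorem eLpNorm_perturbedTriangle (hf : IsAdmissiblePerturbation f)
    (hnn : ∀ x, 0 ≤ triangleFun x + ε * f x) :
    eLpNorm (perturbedTriangle f ε) 1 volume =
      ENNReal.ofReal (1 + ε * ∫ x in (-1 : ℝ)..1, f x) := by
  have hI := integrable_perturbed (ε := ε) hf
  rw [show perturbedTriangle f ε = fun x => ((triangleFun x + ε * f x : ℝ) : ℂ) from rfl,
    eLpNorm_one_eq_lintegral_enorm, ← ofReal_integral_norm_eq_lintegral_enorm hI.ofReal]
  simp_rw [Complex.norm_real, Real.norm_of_nonneg (hnn _)]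
  rw [integral_eq_intervalIntegral_of_support_subset (perturbed_support_subset hf),
    intervalIntegral.integral_add (continuous_triangleFun.intervalIntegrable _ _)
      (hf.contDiffOn.continuousOn.intervalIntegrable_neg_one_one.const_mul ε),
    intervalIntegral.integral_const_mul, integral_triangleFun]

theorem secondMomentNorm_perturbedTriangle (hf : IsAdmissiblePerturbation f)
    (hnn : ∀ x, 0 ≤ triangleFun x + ε * f x) :
    secondMomentNorm (perturbedTriangle f ε) =
      ENNReal.ofReal (1 / 6 + ε * ∫ x in (-1 : ℝ)..1, f x * x ^ 2) := by
  have hs : Function.support (fun x => (triangleFun x + ε * f x) * x ^ 2) ⊆ Icc (-1) 1 :=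
    (Function.support_mul_subset_left _ _).trans (perturbed_support_subset hf)
  have hI : Integrable (fun x => (triangleFun x + ε * f x) * x ^ 2) := by
    rw [← integrableOn_iff_integrable_of_support_subset hs]
    exact ((perturbed_continuousOn hf).mul (by fun_prop)).integrableOn_compact isCompact_Icc
  have h1 : (fun x : ℝ => ‖perturbedTriangle f ε x‖ * x ^ 2) =
      fun x => (triangleFun x + ε * f x) * x ^ 2 := by
    ext x
    rw [perturbedTriangle, Complex.norm_real, Real.norm_of_nonneg (hnn _)]
  have h2 : IntervalIntegrable (fun x => f x * x ^ 2) volume (-1) 1 :=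
    (hf.contDiffOn.continuousOn.mul (by fun_prop)).intervalIntegrable_neg_one_one
  have h3 : IntervalIntegrable (fun x => triangleFun x * x ^ 2) volume (-1) 1 :=
    (continuous_triangleFun.mul (by fun_prop)).intervalIntegrable _ _
  rw [secondMomentNorm_eq, h1, eLpNorm_one_eq_lintegral_enorm,
    ← ofReal_integral_norm_eq_lintegral_enorm hI]
  simp_rw [norm_mul, Real.norm_of_nonneg (hnn _), Real.norm_of_nonneg (sq_nonneg _)]
  rw [integral_eq_intervalIntegral_of_support_subset hs]
  simp_rw [add_mul, mul_assoc]
  rw [intervalIntegral.integral_add h3 (h2.const_mul ε),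
    intervalIntegral.integral_const_mul, integral_triangleFun_mul_sq]

end Perturbed

/-! ### The right derivative of the functional. -/

theorem IsAdmissiblePerturbation.exists_perturbationFunctional_formula {f : ℝ → ℝ}
    (hf : IsAdmissiblePerturbation f) :
    ∃ ε₀ : ℝ, 0 < ε₀ ∧ ∀ ε ∈ Icc 0 ε₀, perturbationFunctional f ε ≠ ∞ ∧
      (perturbationFunctional f ε).toReal =
        (fourierSecondMomentSup (perturbedTriangle f ε)).toReal ^ 2 *
          (1 / 6 + ε * ∫ x in (-1 : ℝ)..1, f x * x ^ 2) ^ 2 /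
          (1 + ε * ∫ x in (-1 : ℝ)..1, f x) ^ 4 := by
  obtain ⟨C, hC0, hC⟩ := hf.exists_abs_le_mul
  obtain ⟨C', hC'⟩ := fourierSecondMomentSup_perturbed_bounds hf
  have hm : 0 ≤ ∫ x in (-1 : ℝ)..1, f x := by
    simpa [cosTransform] using hf.cosTransform_nonneg 0
  -- This ensures `ε C ≤ 1`, hence `|ε f| ≤ u₀`; the `+ 1` covers `C = 0`.
  refine ⟨1 / (C + 1), by positivity, fun ε hε => ?_⟩
  have hnn (x : ℝ) : 0 ≤ triangleFun x + ε * f x := by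
    have h1 : ε * C ≤ 1 := by
      have := (le_div_iff₀ (by positivity)).1 hε.2
      nlinarith [hε.1]
    have h2 : |ε * f x| ≤ triangleFun x := by
      rw [abs_mul, abs_of_nonneg hε.1]
      calc ε * |f x| ≤ ε * (C * triangleFun x) := mul_le_mul_of_nonneg_left (hC x) hε.1
        _ = ε * C * triangleFun x := by ring
        _ ≤ triangleFun x := mul_le_of_le_one_left (le_max_right _ _) h1
    linarith [neg_abs_le (ε * f x)]
  have hD : 0 < 1 + ε * ∫ x in (-1 : ℝ)..1, f x := by nlinarith [mul_nonneg hε.1 hm]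
  have hN : 0 ≤ 1 / 6 + ε * ∫ x in (-1 : ℝ)..1, f x * x ^ 2 := by
    have hi1 : IntervalIntegrable (fun x => triangleFun x * x ^ 2) volume (-1) 1 :=
      (continuous_triangleFun.mul (by fun_prop)).intervalIntegrable _ _
    have hi2 : IntervalIntegrable (fun x => f x * x ^ 2) volume (-1) 1 :=
      (hf.contDiffOn.continuousOn.mul (by fun_prop)).intervalIntegrable_neg_one_one
    rw [← integral_triangleFun_mul_sq, ← intervalIntegral.integral_const_mul,
      ← intervalIntegral.integral_add hi1 (hi2.const_mul ε)]
    refine intervalIntegral.integral_nonneg (by norm_num) fun x _ => ?_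
    have := mul_nonneg (hnn x) (sq_nonneg x)
    linarith
  rw [perturbationFunctional, uncertaintyQuotient, secondMomentNorm_perturbedTriangle hf hnn,
    eLpNorm_perturbedTriangle hf hnn]
  constructor
  · refine ENNReal.div_ne_top (ENNReal.mul_ne_top (ENNReal.pow_ne_top (hC' ε hε.1).1)
      (ENNReal.pow_ne_top ENNReal.ofReal_ne_top)) (pow_ne_zero _ ?_)
    exact (ENNReal.ofReal_pos.2 hD).ne'
  · rw [ENNReal.toReal_div, ENNReal.toReal_mul, ENNReal.toReal_pow, ENNReal.toReal_pow,
      ENNReal.toReal_pow, ENNReal.toReal_ofReal hN, ENNReal.toReal_ofReal hD.le]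

theorem IsAdmissiblePerturbation.exists_hasDerivWithinAt_pos {f : ℝ → ℝ}
    (hf : IsAdmissiblePerturbation f) (hne : f ≠ 0) :
    ∃ d : ℝ, 0 < d ∧
      HasDerivWithinAt (fun ε : ℝ => (perturbationFunctional f ε).toReal) d (Ici 0) 0 := by
  obtain ⟨ε₀, hε₀, hform⟩ := hf.exists_perturbationFunctional_formula
  obtain ⟨C, hC⟩ := fourierSecondMomentSup_perturbed_bounds hf
  have hπ := Real.pi_pos
  set m := ∫ x in (-1 : ℝ)..1, f x with hm
  set n := ∫ x in (-1 : ℝ)..1, f x * x ^ 2 with hn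
  set S : ℝ → ℝ := fun ε => (fourierSecondMomentSup (perturbedTriangle f ε)).toReal with hS
  have hpos : 0 < oddSup f / 4 + (6 * n - 2 * m) := by
    have h1 := hf.moment_positivity hne (G := oddSup f) fun j hj => by
      obtain ⟨i, rfl⟩ := hj
      have := hf.le_oddSup i
      push_cast at this ⊢
      rwa [mul_comm Real.pi]
    have h2 : ∫ x in (-1 : ℝ)..1, f x * (6 * x ^ 2 - 2) = 6 * n - 2 * m := by
      have hi1 : IntervalIntegrable (fun x => f x * x ^ 2) volume (-1) 1 :=
        (hf.contDiffOn.continuousOn.mul (by fun_prop)).intervalIntegrable_neg_one_one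
      have hi2 : IntervalIntegrable f volume (-1) 1 :=
        hf.contDiffOn.continuousOn.intervalIntegrable_neg_one_one
      rw [hm, hn, ← intervalIntegral.integral_const_mul, ← intervalIntegral.integral_const_mul,
        ← intervalIntegral.integral_sub (hi1.const_mul 6) (hi2.const_mul 2)]
      congr with x
      ring
    rwa [h2] at h1
  have hS0 : S 0 = 1 / Real.pi ^ 2 :=
    le_antisymm (by simpa using (hC 0 le_rfl).2.2) (by simpa using (hC 0 le_rfl).2.1)
  have hSd : HasDerivWithinAt S (oddSup f / (4 * Real.pi ^ 2)) (Ici 0) 0 :=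
    hasDerivWithinAt_Ici_zero_of_quadratic_error (fun ε hε => (hC ε hε).2.1)
      (fun ε hε => (hC ε hε).2.2)
  have hlin (a b : ℝ) : HasDerivWithinAt (fun ε : ℝ => a + ε * b) b (Ici 0) 0 := by
    simpa using (((hasDerivAt_id (0 : ℝ)).mul_const b).const_add a).hasDerivWithinAt
  have hJ := ((hSd.pow 2).mul ((hlin (1 / 6) n).pow 2)).div ((hlin 1 m).pow 4) (by simp)
  -- Here `J(0) = 1/(36π⁴)`, and the logarithmic derivative at `0` is `2 · G/4 + 2 · 6n - 4m`.
  refine ⟨1 / (18 * Real.pi ^ 4) * (oddSup f / 4 + (6 * n - 2 * m)), by positivity, ?_⟩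
  refine (hJ.congr_of_eventuallyEq ?_ ?_).congr_deriv ?_
  · filter_upwards [Icc_mem_nhdsGE hε₀] with ε hε using (hform ε hε).2
  · exact (hform 0 ⟨le_rfl, hε₀.le⟩).2
  · simp [hS0]
    field_simp
    ring

theorem theorem7 :
    (∃ c : ℝ, 0 < c ∧ ∀ u : ℝ → ℂ, Integrable u volume →
      ENNReal.ofReal c * eLpNorm u 1 volume ^ 4 ≤
        fourierSecondMomentSup u ^ 2 * secondMomentNorm u ^ 2) ∧
    (∀ f : ℝ → ℝ, IsAdmissiblePerturbation f → f ≠ 0 →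
      (∃ ε₀ : ℝ, 0 < ε₀ ∧ ∀ ε ∈ Icc 0 ε₀, perturbationFunctional f ε ≠ ∞) ∧
      (∃ d : ℝ, 0 < d ∧
        HasDerivWithinAt (fun ε : ℝ => (perturbationFunctional f ε).toReal) d (Ici 0) 0) ∧
      (∃ ε₀ : ℝ, 0 < ε₀ ∧ ∀ ε ∈ Ioc 0 ε₀,
        perturbationFunctional f 0 < perturbationFunctional f ε)) := by
  refine ⟨⟨1 / (128 * Real.pi ^ 2) ^ 2, by positivity, fun u hu => eLpNorm_one_pow_four_le hu⟩,
    fun f hf hne => ?_⟩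
  obtain ⟨ε₀, hε₀, hform⟩ := hf.exists_perturbationFunctional_formula
  obtain ⟨d, hd, hderiv⟩ := hf.exists_hasDerivWithinAt_pos hne
  refine ⟨⟨ε₀, hε₀, fun ε hε => (hform ε hε).1⟩, ⟨d, hd, hderiv⟩, ?_⟩
  have hslope := (hasDerivWithinAt_iff_tendsto_slope' (notMem_Ioi.2 le_rfl)).1 hderiv.Ioi_of_Ici
  have hev := hslope.eventually (lt_mem_nhds hd)
  obtain ⟨ε₁, hε₁, hsub⟩ := mem_nhdsGT_iff_exists_Ioc_subset.1 hev
  refine ⟨min ε₀ ε₁, lt_min hε₀ hε₁, fun ε hε => ?_⟩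
  have h1 : 0 < slope (fun ε : ℝ => (perturbationFunctional f ε).toReal) 0 ε :=
    hsub ⟨hε.1, hε.2.trans (min_le_right _ _)⟩
  rw [slope_def_field, sub_zero, div_pos_iff_of_pos_right hε.1, sub_pos] at h1
  exact (ENNReal.toReal_lt_toReal (hform 0 ⟨le_rfl, hε₀.le⟩).1
    (hform ε ⟨hε.1.le, hε.2.trans (min_le_left _ _)⟩).1).1 h1
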